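/- For $f\in L^2(\mathbb{R})$ let $\widehat f$ denote its (unitary) Fourier transform, given by $\widehat f(\gamma)=\int_{\mathbb{R}} f(x)e^{-2\pi i x\gamma}\,dx$ for $f\in L^1(\mathbb{R})\cap L^2(\mathbb{R})$, and for $k\in\mathbb{Z}$ let $T_kf(x)=f(x-k)$. A family $\{f_k\}_{k\in\mathbb{Z}}\subset L^2(\mathbb{R})$ is a Bessel sequence if there is $\beta>0$ such that $\sum_{k\in\mathbb{Z}}|\langle g,f_k\rangle|^2\le\beta\|g\|^2$ for all $g\in L^2(\mathbb{R})$. Let $\phi,\phi_1\in L^2(\mathbb{R})$ be such that $\{T_k\phi\}_{k\in\mathbb{Z}}$ and $\{T_k\phi_1\}_{k\in\mathbb{Z}}$ are Bessel sequences. Put $\mathcal{W}=\overline{\mathrm{span}}\{T_k\phi\}_{k\in\mathbb{Z}}$, $\mathcal{V}=\overline{\mathrm{span}}\{T_k\phi_1\}_{k\in\mathbb{Z}}$ and $\Phi(\gamma)=\sum_{k\in\mathbb{Z}}|\widehat\phi(\gamma+k)|^2$ for $\gamma\in[0,1]$. Let $\tilde\phi\in\mathcal{V}$ satisfy $\widehat{\tilde\phi}=\tilde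 H\,\widehat{\phi_1}$ a.e. on $\mathbb{R}$, where $\tilde H\in L^\infty(0,1)$ is extended $1$-periodically to $\mathbb{R}$. Let $\varepsilon\ge 0$. Then $\{T_k\tilde\phi\}_{k\in\mathbb{Z}}$ is a Bessel sequence; the series $\sum_{k\in\mathbb{Z}}\langle f,T_k\tilde\phi\rangle T_k\phi$ converges unconditionally in $L^2(\mathbb{R})$ for every $f\in L^2(\mathbb{R})$; the series $\sum_{n\in\mathbb{Z}}\widehat\phi(\gamma+n)\overline{\widehat{\phi_1}(\gamma+n)}$ converges absolutely for a.e. $\gamma\in[0,1]$; and the following are equivalent: 1. $\bigl\|f-\sum_{k\in\mathbb{Z}}\langle f,T_k\tilde\phi\rangle T_k\phi\bigr\|\le\varepsilon\|f\|$ for all $f\in\mathcal{W}$; 2. $\Bigl|\overline{\tilde H(\gamma)}\sum_{n\in\mathbb{Z}}\widehat\phi(\gamma+n)\overline{\widehat{\phi_1}(\gamma+n)}-1\Bigr|\le\varepsilon$ for a.e. $\gamma\in\{\gamma\in[0,1]:\Phi(\gamma)\ne 0\}$. -/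

import Mathlib

open MeasureTheory FourierTransform
open scoped ENNReal

noncomputable section

/-- The Hilbert space `L²(ℝ)` of complex-valued functions. -/
abbrev L2R : Type := Lp ℂ 2 (volume : Measure ℝ)

/-- The translation operator `T_k f (x) = f (x - k)` on `L²(ℝ)`, for an integer `k`. -/
def shiftL2 (k : ℤ) : L2R →ₗᵢ[ℂ] L2R :=
  Lp.compMeasurePreservingₗᵢ ℂ (fun x : ℝ => x - (k : ℝ))
    (measurePreserving_sub_right volume (k : ℝ))

/-- A family `(f_k)` in a complex Hilbert space is a Bessel sequence: there is a constant `β > 0`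
with `∑ |⟨g, f_k⟩|² ≤ β ‖g‖²` for all `g`. Mathlib's inner product is conjugate-linear in its first
argument, so `⟨g, f_k⟩` is `inner ℂ (f_k) g`. -/
def IsBesselSeq {ι E : Type*} [NormedAddCommGroup E] [InnerProductSpace ℂ E] (f : ι → E) : Prop :=
  ∃ β : ℝ, 0 < β ∧ ∀ g : E,
    Summable (fun k => ‖inner ℂ (f k) g‖ ^ 2) ∧ ∑' k, ‖inner ℂ (f k) g‖ ^ 2 ≤ β * ‖g‖ ^ 2

/-- The closed linear span of the integer translates of `φ`. -/
def shiftSpan (φ : L2R) : Submodule ℂ L2R :=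
  (Submodule.span ℂ (Set.range fun k : ℤ => shiftL2 k φ)).topologicalClosure

/-- `Φ(γ) = ∑_k |φ̂(γ + k)|²`, as a sum of non-negative extended reals (it is finite for almost
every `γ`); `𝓕` is the unitary Fourier transform of `L²(ℝ)` with kernel `exp (-2 π i x γ)`. -/
def periodSq (φ : L2R) (γ : ℝ) : ℝ≥0∞ :=
  ∑' k : ℤ, ‖(𝓕 φ : L2R) (γ + k)‖ₑ ^ 2

/-- The `n`-th term `φ̂(γ + n) · conj (ψ̂(γ + n))`. -/
def bracketTerm (φ ψ : L2R) (γ : ℝ) (n : ℤ) : ℂ :=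
  (𝓕 φ : L2R) (γ + n) * starRingEnd ℂ ((𝓕 ψ : L2R) (γ + n))

end

/-! Write `[f, ψ](γ) = ∑ₙ f̂(γ + n) conj ψ̂(γ + n)`. On the Fourier side `T_k` is multiplication by
`exp (-2πikγ)`, so the numbers `⟨f, T_k ψ⟩` are, up to the sign of the index, the Fourier
coefficients of the periodic function `[f, ψ]`. Summing the series gives `(∑ ⟨f, T_k ψ⟩ T_k φ)^ =
[f, ψ] φ̂` (`fourier_tsum_inner_shiftL2`). Elements of `shiftSpan φ` satisfy `f̂ = q φ̂` with `q`
periodic (`mem_shiftSpan_iff`). Hence `[f, φt] φ̂ = q [φ, φt] φ̂ = m f̂` with `m = conj H · [φ,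
φ₁]`, and the approximation error is multiplication of `f̂` by `1 - m`. A pointwise bound on `1 - m`
where `Φ ≠ 0` then gives the norm bound by Plancherel. Conversely, the norm bound is tested on `f̂ =
1_S φ̂` with `S = {|m - 1| > ε}`, which forces `φ̂ = 0` on `S`. -/

/-! ### Almost-everywhere statements and periodicity. -/

/-- A property invariant under integer translation that holds almost everywhere on the unit
interval holds almost everywhere. -/
theorem ae_of_ae_restrict_Ioc_of_periodic {P : ℝ → Prop} (hP : ∀ (n : ℤ) x, P (x + n) → P x)
    (h : ∀ᵐ x ∂(volume.restrict (Set.Ioc (0 : ℝ) 1)), P x) : ∀ᵐ x : ℝ, P x := by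
  rw [← Measure.restrict_univ (μ := (volume : Measure ℝ)), ← iUnion_Ioc_intCast ℝ,
    ae_restrict_iUnion_iff]
  intro n
  have hm : MeasurePreserving (fun x : ℝ => x + ((-n : ℤ) : ℝ)) volume volume :=
    measurePreserving_add_right _ _
  have h2 := (hm.restrict_preimage (measurableSet_Ioc (a := (0 : ℝ)) (b := 1))
    ).quasiMeasurePreserving.ae h
  have h3 : (fun x : ℝ => x + ((-n : ℤ) : ℝ)) ⁻¹' Set.Ioc 0 1 = Set.Ioc (n : ℝ) (n + 1) := by
    ext x
    simp only [Set.mem_preimage, Set.mem_Ioc, Int.cast_neg]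
    constructor <;> rintro ⟨h1, h2⟩ <;> constructor <;> linarith
  rw [h3] at h2
  filter_upwards [h2] with x hx using hP _ x hx

theorem ae_forall_int_add {P : ℝ → Prop} (h : ∀ᵐ x : ℝ, P x) : ∀ᵐ x : ℝ, ∀ n : ℤ, P (x + n) := by
  rw [ae_all_iff]
  intro n
  exact (measurePreserving_add_right volume (n : ℝ)).quasiMeasurePreserving.ae h

theorem ae_coe_unitAddCircle {P : UnitAddCircle → Prop} (h : ∀ᵐ x, P x) :
    ∀ᵐ x : ℝ, P (x : UnitAddCircle) := by
  refine ae_of_ae_restrict_Ioc_of_periodic (fun n x hx => ?_) ?_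
  · have : ((x + n : ℝ) : UnitAddCircle) = x := by simp
    rwa [this] at hx
  · have := (UnitAddCircle.measurePreserving_mk 0).quasiMeasurePreserving.ae h
    simpa using this

theorem periodic_add_int {α : Type*} {q : ℝ → α} (hq : Function.Periodic q 1) (x : ℝ) (n : ℤ) :
    q (x + n) = q x := by
  simpa using hq.int_mul n x

/-! ### Periodization and uniqueness of Fourier coefficients. -/

/-- Periodization of an integrable function. -/
theorem MeasureTheory.Integrable.periodization {F : ℝ → ℂ} (hF : Integrable F) :
    (∀ᵐ x : ℝ, Summable fun n : ℤ => F (x + n)) ∧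
    IntegrableOn (fun x => ∑' n : ℤ, F (x + n)) (Set.Ioc 0 1) ∧
    ∫ x, F x = ∫ x in Set.Ioc (0 : ℝ) 1, ∑' n : ℤ, F (x + n) := by
  have hi : ∀ n : ℤ, IntegrableOn (fun x : ℝ => F (x + n)) (Set.Ioc 0 1) := fun n =>
    (hF.comp_add_right (n : ℝ)).integrableOn
  have hs := hF.norm.hasSum_intervalIntegral_comp_add_int
  have hs' := hF.hasSum_intervalIntegral_comp_add_int
  simp only [intervalIntegral.integral_of_le (zero_le_one' ℝ)] at hs hs'
  -- These integrals add up to the `L¹` norm of `F`; finiteness yields both a.e. summability and the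
  -- exchange of sum and integral.
  have hfin : ∑' n : ℤ, ∫⁻ x in Set.Ioc (0 : ℝ) 1, ‖F (x + n)‖ₑ ≠ ∞ := by
    have : ∀ n : ℤ, ∫⁻ x in Set.Ioc (0 : ℝ) 1, ‖F (x + n)‖ₑ =
        ENNReal.ofReal (∫ x in Set.Ioc (0 : ℝ) 1, ‖F (x + n)‖) := fun n => by
      rw [ofReal_integral_norm_eq_lintegral_enorm (hi n)]
    simp_rw [this]
    exact hs.summable.tsum_ofReal_ne_top
  have hsum : ∀ᵐ x ∂(volume.restrict (Set.Ioc (0 : ℝ) 1)), ∑' n : ℤ, ‖F (x + n)‖ₑ < ∞ := by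
    refine ae_lt_top' (AEMeasurable.tsum fun n => (hi n).1.enorm) ?_
    rwa [lintegral_tsum fun n => (hi n).1.enorm]
  have hsum' : ∀ᵐ x ∂(volume.restrict (Set.Ioc (0 : ℝ) 1)), Summable fun n : ℤ => F (x + n) := by
    filter_upwards [hsum] with x hx
    refine Summable.of_norm ?_
    have := ENNReal.tsum_coe_ne_top_iff_summable.1 hx.ne
    exact NNReal.summable_coe.2 this
  refine ⟨ae_of_ae_restrict_Ioc_of_periodic (fun m x hx => ?_) hsum', ⟨?_, ?_⟩, ?_⟩
  · have := (Equiv.addLeft (-m)).summable_iff.2 hx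
    refine this.congr fun n => ?_
    simp
  · have hlim : ∀ᵐ x ∂(volume.restrict (Set.Ioc (0 : ℝ) 1)),
        Filter.Tendsto (fun s : Finset ℤ => ∑ n ∈ s, F (x + n)) Filter.atTop
          (nhds (∑' n : ℤ, F (x + n))) := by
      filter_upwards [hsum'] with x hx using hx.hasSum
    exact aestronglyMeasurable_of_tendsto_ae _
      (fun s => Finset.aestronglyMeasurable_fun_sum s fun n _ => (hi n).1) hlim
  · refine lt_of_le_of_lt (lintegral_mono fun x => enorm_tsum_le_tsum_enorm) ?_
    rw [lintegral_tsum fun n => (hi n).1.enorm]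
    exact hfin.lt_top
  · rw [← hs'.tsum_eq]
    exact (integral_tsum (fun n => (hi n).1) hfin).symm

/-- Uniqueness of Fourier coefficients for integrable functions on the unit interval. -/
theorem ae_eq_zero_of_integral_fourier_mul_eq_zero {F : ℝ → ℂ}
    (hF : IntegrableOn F (Set.Ioc 0 1))
    (h : ∀ k : ℤ, ∫ x in Set.Ioc (0 : ℝ) 1, fourier k (x : UnitAddCircle) * F x = 0) :
    ∀ᵐ x ∂(volume.restrict (Set.Ioc (0 : ℝ) 1)), F x = 0 := by
  have hcm : ∀ p : C(UnitAddCircle, ℂ), Continuous fun x : ℝ => p (x : UnitAddCircle) :=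
    fun p => p.continuous.comp (AddCircle.continuous_mk' 1)
  have hbd : ∀ p : C(UnitAddCircle, ℂ),
      IntegrableOn (fun x : ℝ => p (x : UnitAddCircle) * F x) (Set.Ioc 0 1) := fun p =>
    hF.bdd_mul (hcm p).aestronglyMeasurable (c := ‖p‖)
      (Filter.Eventually.of_forall fun x => p.norm_coe_le_norm _)
  let Λ : C(UnitAddCircle, ℂ) →ₗ[ℂ] ℂ :=
    { toFun := fun p => ∫ x in Set.Ioc (0 : ℝ) 1, p (x : UnitAddCircle) * F x
      map_add' := fun p q => by
        simp only [ContinuousMap.add_apply, add_mul]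
        exact integral_add (hbd p) (hbd q)
      map_smul' := fun c p => by
        simp only [ContinuousMap.smul_apply, smul_eq_mul, mul_assoc, RingHom.id_apply]
        exact integral_const_mul _ _ }
  have hΛc : Continuous Λ := by
    refine AddMonoidHomClass.continuous_of_bound Λ (∫ x in Set.Ioc (0 : ℝ) 1, ‖F x‖) fun p => ?_
    calc ‖Λ p‖ ≤ ∫ x in Set.Ioc (0 : ℝ) 1, ‖p (x : UnitAddCircle) * F x‖ :=
          norm_integral_le_integral_norm _
      _ ≤ ∫ x in Set.Ioc (0 : ℝ) 1, ‖F x‖ * ‖p‖ := by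
          refine integral_mono (hbd p).norm (hF.norm.mul_const _) fun x => ?_
          simp only [norm_mul]
          rw [mul_comm]
          exact mul_le_mul_of_nonneg_left (p.norm_coe_le_norm _) (norm_nonneg _)
      _ = _ := integral_mul_const _ _
  -- `Λ` is sup-norm continuous and kills every character, and trigonometric polynomials are dense
  -- in the continuous functions on the circle.
  have hker : ∀ p, Λ p = 0 := by
    have h1 : (Submodule.span ℂ (Set.range (fourier (T := 1)))).topologicalClosure ≤
        LinearMap.ker Λ := by
      refine Submodule.topologicalClosure_minimal _ (Submodule.span_le.2 ?_)
        (isClosed_singleton.preimage hΛc)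
      rintro _ ⟨k, rfl⟩
      exact h k
    have : Fact ((0 : ℝ) < 1) := ⟨one_pos⟩
    rw [span_fourier_closure_eq_top] at h1
    exact fun p => h1 trivial
  -- On the open interval, test functions vanish at both endpoints and so descend to continuous
  -- functions on the circle.
  rw [← Measure.restrict_congr_set Ioo_ae_eq_Ioc, ae_restrict_iff' measurableSet_Ioo]
  refine isOpen_Ioo.ae_eq_zero_of_integral_contDiff_smul_eq_zero
    (hF.mono_set Set.Ioo_subset_Ioc_self).locallyIntegrableOn fun g hg hgc hgs => ?_
  have hg0 : ∀ x ∉ Set.Ioo (0 : ℝ) 1, g x = 0 := fun x hx =>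
    image_eq_zero_of_notMem_tsupport fun h => hx (hgs h)
  have : Fact ((0 : ℝ) < 1) := ⟨one_pos⟩
  let p : C(UnitAddCircle, ℂ) :=
    ⟨AddCircle.liftIco 1 0 fun x => (g x : ℂ), AddCircle.liftIco_continuous
      (by simp [hg0]) (Complex.continuous_ofReal.comp hg.continuous).continuousOn⟩
  have hp : ∫ x in Set.Ioc (0 : ℝ) 1, p (x : UnitAddCircle) * F x = 0 := hker p
  rw [integral_Ioc_eq_integral_Ioo] at hp
  rw [← setIntegral_eq_integral_of_forall_compl_eq_zero (s := Set.Ioo 0 1)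
    fun x hx => by rw [hg0 x hx, zero_smul], ← hp]
  refine setIntegral_congr_fun measurableSet_Ioo fun x hx => ?_
  have : p (x : UnitAddCircle) = g x :=
    AddCircle.liftIco_zero_coe_apply (f := fun x => (g x : ℂ)) (Set.Ioo_subset_Ico_self hx)
  simp only [this, Complex.real_smul]

/-! ### Bessel sequences, Fourier multipliers and translations. -/

/-- Square-summable combinations of a Bessel sequence converge unconditionally. -/
theorem IsBesselSeq.summable_smul {ι E : Type*} [NormedAddCommGroup E] [InnerProductSpace ℂ E]
    [CompleteSpace E] {f : ι → E} (hf : IsBesselSeq f) {c : ι → ℂ}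
    (hc : Summable fun k => ‖c k‖ ^ 2) : Summable fun k => c k • f k := by
  obtain ⟨β, hβ, hB⟩ := hf
  -- Duality: expand `‖v‖²` as an inner product, apply Cauchy–Schwarz and the Bessel bound to `v`
  -- itself, then cancel `‖v‖²`.
  have key : ∀ s : Finset ι, ‖∑ k ∈ s, c k • f k‖ ^ 2 ≤ β * ∑ k ∈ s, ‖c k‖ ^ 2 := by
    intro s
    set v := ∑ k ∈ s, c k • f k with hv
    have h1 : ‖v‖ ^ 2 ≤ ∑ k ∈ s, ‖c k‖ * ‖inner ℂ (f k) v‖ := by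
      calc ‖v‖ ^ 2 = ‖inner ℂ v v‖ := by rw [inner_self_eq_norm_sq_to_K]; simp
        _ = ‖∑ k ∈ s, inner ℂ (c k • f k) v‖ := by rw [← sum_inner, ← hv]
        _ ≤ ∑ k ∈ s, ‖inner ℂ (c k • f k) v‖ := norm_sum_le _ _
        _ = _ := Finset.sum_congr rfl fun k _ => by simp [mul_comm]
    have h2 := Finset.sum_mul_sq_le_sq_mul_sq s (fun k => ‖c k‖) fun k => ‖inner ℂ (f k) v‖
    have h3 : ∑ k ∈ s, ‖inner ℂ (f k) v‖ ^ 2 ≤ β * ‖v‖ ^ 2 :=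
      ((hB v).1.sum_le_tsum s fun _ _ => by positivity).trans (hB v).2
    have h4 : (‖v‖ ^ 2) ^ 2 ≤ (∑ k ∈ s, ‖c k‖ ^ 2) * (β * ‖v‖ ^ 2) :=
      (pow_le_pow_left₀ (by positivity) h1 2).trans
        (h2.trans (mul_le_mul_of_nonneg_left h3 (by positivity)))
    rcases (sq_nonneg ‖v‖).eq_or_lt with h0 | h0
    · rw [← h0]; positivity
    · nlinarith
  rw [summable_iff_vanishing_norm]
  intro ε hε
  obtain ⟨s, hs⟩ := summable_iff_vanishing_norm.1 hc (ε ^ 2 / β) (by positivity)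
  refine ⟨s, fun t ht => ?_⟩
  have h1 := hs t ht
  rw [Real.norm_of_nonneg (by positivity), lt_div_iff₀ hβ] at h1
  exact lt_of_pow_lt_pow_left₀ 2 hε.le (by linarith [key t])

/-- Multiplication by an essentially bounded function on `L²(ℝ)`. -/
theorem exists_mul_L2R {u : ℝ → ℂ} (hu : MemLp u ∞ volume) :
    ∃ A : L2R →L[ℂ] L2R, ∀ g : L2R, ∀ᵐ x : ℝ, A g x = u x * g x := by
  let U : Lp ℂ ∞ (volume : Measure ℝ) := hu.toLp u
  refine ⟨(ContinuousLinearMap.mul ℂ ℂ).holderL volume ∞ 2 2 U, fun g => ?_⟩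
  filter_upwards [(ContinuousLinearMap.mul ℂ ℂ).coeFn_holder (r := 2) U g, hu.coeFn_toLp]
    with x hx hx'
  rw [← hx']
  exact hx

theorem memLp_top_fourier (k : ℤ) :
    MemLp (fun x : ℝ => fourier k (x : UnitAddCircle)) ∞ volume := by
  refine memLp_top_of_bound ?_ 1 (Filter.Eventually.of_forall fun x => ?_)
  · exact ((fourier k).continuous.comp (AddCircle.continuous_mk' 1)).aestronglyMeasurable
  · rw [fourier_apply]
    exact (Circle.norm_coe _).le

/-- The Fourier transform intertwines translation and modulation. -/
theorem fourier_shiftL2 (k : ℤ) (f : L2R) : ∀ᵐ x : ℝ,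
    (𝓕 (shiftL2 k f) : L2R) x = fourier (-k) (x : UnitAddCircle) * (𝓕 f : L2R) x := by
  obtain ⟨A, hA⟩ := exists_mul_L2R (memLp_top_fourier (-k))
  suffices h : (𝓕 (shiftL2 k f) : L2R) = A (𝓕 f : L2R) by
    rw [h]; exact hA _
  refine DenseRange.induction_on (p := fun f => (𝓕 (shiftL2 k f) : L2R) = A (𝓕 f : L2R))
    (SchwartzMap.denseRange_toLpCLM (p := 2) ENNReal.ofNat_ne_top) f ?_ fun g => ?_
  · exact isClosed_eq ((Lp.fourierTransformₗᵢ ℝ ℂ).continuous.comp (shiftL2 k).continuous)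
      (A.continuous.comp (Lp.fourierTransformₗᵢ ℝ ℂ).continuous)
  · have h1 : shiftL2 k (g.toLp 2) = (g.compSubConstCLM ℂ (k : ℝ)).toLp 2 := by
      apply Lp.ext
      have hm : MeasurePreserving (fun x : ℝ => x - (k : ℝ)) volume volume :=
        measurePreserving_sub_right volume (k : ℝ)
      filter_upwards [Lp.coeFn_compMeasurePreserving (g.toLp 2) hm,
        hm.quasiMeasurePreserving.ae (g.coeFn_toLp 2 volume),
        (g.compSubConstCLM ℂ (k : ℝ)).coeFn_toLp 2 volume] with x h1 h2 h3
      rw [h3, SchwartzMap.compSubConstCLM_apply, ← h2]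
      exact h1
    change (𝓕 (shiftL2 k (g.toLp 2)) : L2R) = A (𝓕 (g.toLp 2) : L2R)
    rw [h1, SchwartzMap.toLp_fourier_eq, SchwartzMap.toLp_fourier_eq]
    apply Lp.ext
    filter_upwards [hA ((𝓕 g).toLp 2), (𝓕 g).coeFn_toLp 2 volume,
      (𝓕 (g.compSubConstCLM ℂ (k : ℝ))).coeFn_toLp 2 volume] with x h1 h2 h3
    rw [h1, h2, h3, SchwartzMap.fourier_coe, SchwartzMap.fourier_coe]
    have h4 : ⇑(g.compSubConstCLM ℂ (k : ℝ)) = ⇑g ∘ fun v => v + (-k : ℝ) := by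
      ext v; simp [sub_eq_add_neg]
    have h5 := congrFun (VectorFourier.fourierIntegral_comp_add_right Real.fourierChar volume
      (innerₗ ℝ) (g : ℝ → ℂ) (-k : ℝ)) x
    rw [h4]
    refine h5.trans ?_
    rw [Circle.smul_def, smul_eq_mul]
    congr 1
    rw [Real.fourierChar_apply, fourier_coe_apply]
    congr 1
    simp
    ring

theorem inner_shiftL2 (k : ℤ) (ψ f : L2R) : inner ℂ (shiftL2 k ψ) f =
    ∫ x : ℝ, fourier k (x : UnitAddCircle) *
      ((𝓕 f : L2R) x * starRingEnd ℂ ((𝓕 ψ : L2R) x)) := by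
  rw [← Lp.inner_fourier_eq, L2.inner_def]
  refine integral_congr_ae ?_
  filter_upwards [fourier_shiftL2 k ψ] with x hx
  rw [hx, RCLike.inner_apply, map_mul, fourier_neg, Complex.conj_conj]
  ring

theorem integrable_fourier_mul_conj (f ψ : L2R) :
    Integrable fun x : ℝ => (𝓕 f : L2R) x * starRingEnd ℂ ((𝓕 ψ : L2R) x) := by
  simpa only [RCLike.inner_apply] using L2.integrable_inner (𝕜 := ℂ) (𝓕 ψ : L2R) (𝓕 f : L2R)

/-- A bounded Fourier multiplier maps Bessel systems of translates to such systems. -/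
theorem IsBesselSeq.of_fourier_eq_mul {φ₁ φt : L2R} {H : ℝ → ℂ}
    (hφ₁ : IsBesselSeq fun k : ℤ => shiftL2 k φ₁) (hH : MemLp H ∞ volume)
    (h : ∀ᵐ γ : ℝ, (𝓕 φt : L2R) γ = H γ * (𝓕 φ₁ : L2R) γ) :
    IsBesselSeq fun k : ℤ => shiftL2 k φt := by
  obtain ⟨A, hA⟩ := exists_mul_L2R hH.star
  obtain ⟨β, hβ, hB⟩ := hφ₁
  -- The multiplier moves to the other side of the inner product as its conjugate, which does not
  -- depend on `k`.
  have key : ∀ (g : L2R) (k : ℤ),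
      inner ℂ (shiftL2 k φt) g = inner ℂ (shiftL2 k φ₁) (𝓕⁻ (A (𝓕 g : L2R)) : L2R) := by
    intro g k
    rw [inner_shiftL2, inner_shiftL2, FourierTransform.fourier_fourierInv_eq]
    refine integral_congr_ae ?_
    filter_upwards [h, hA (𝓕 g : L2R)] with x h1 h2
    rw [h1, h2, map_mul, Pi.star_apply, starRingEnd_apply (H x)]
    ring
  -- The `+ 1` keeps the Bessel constant positive when `A = 0`.
  refine ⟨β * (‖A‖ ^ 2 + 1), by positivity, fun g => ?_⟩
  simp only [key]
  refine ⟨(hB _).1, (hB _).2.trans ?_⟩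
  have h1 : ‖(𝓕⁻ (A (𝓕 g : L2R)) : L2R)‖ ≤ ‖A‖ * ‖g‖ := by
    rw [← Lp.norm_fourier_eq, FourierTransform.fourier_fourierInv_eq, ← Lp.norm_fourier_eq g]
    exact A.le_opNorm _
  rw [mul_assoc]
  refine mul_le_mul_of_nonneg_left ?_ hβ.le
  nlinarith [pow_le_pow_left₀ (norm_nonneg _) h1 2, sq_nonneg ‖g‖]

open Filter Topology in
/-- An `L²` limit can be computed almost everywhere along a subsequence. -/
theorem exists_subseq_tendsto_ae_of_tendsto_Lp {α : Type*} [MeasurableSpace α] {μ : Measure α}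
    {f : ℕ → Lp ℂ 2 μ} {g : Lp ℂ 2 μ} (h : Tendsto f atTop (𝓝 g)) :
    ∃ ns : ℕ → ℕ, Tendsto ns atTop atTop ∧
      ∀ᵐ x ∂μ, Tendsto (fun i => f (ns i) x) atTop (𝓝 (g x)) := by
  obtain ⟨ns, h1, h2⟩ := (tendstoInMeasure_of_tendsto_Lp h).exists_seq_tendsto_ae
  exact ⟨ns, h1.tendsto_atTop, h2⟩

/-! ### The bracket product and the mixed frame operator. -/

theorem bracketTerm_summable_integrableOn (f ψ : L2R) :
    (∀ᵐ x : ℝ, Summable (bracketTerm f ψ x)) ∧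
    IntegrableOn (fun x => ∑' n : ℤ, bracketTerm f ψ x n) (Set.Ioc 0 1) :=
  ⟨(integrable_fourier_mul_conj f ψ).periodization.1,
    (integrable_fourier_mul_conj f ψ).periodization.2.1⟩

theorem periodic_tsum_bracketTerm (f ψ : L2R) :
    Function.Periodic (fun x => ∑' n : ℤ, bracketTerm f ψ x n) 1 := by
  intro x
  dsimp only
  rw [← (Equiv.addLeft (1 : ℤ)).tsum_eq (bracketTerm f ψ x)]
  refine tsum_congr fun n => ?_
  simp [bracketTerm, add_assoc]

theorem periodic_periodSq (φ : L2R) : Function.Periodic (periodSq φ) 1 := by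
  intro x
  unfold periodSq
  rw [← (Equiv.addLeft (1 : ℤ)).tsum_eq (fun k : ℤ => ‖(𝓕 φ : L2R) (x + k)‖ₑ ^ 2)]
  refine tsum_congr fun n => ?_
  simp [add_assoc]

theorem tsum_bracketTerm_of_fourier_eq_mul {f φ : L2R} {q : ℝ → ℂ} (hq : Function.Periodic q 1)
    (h : ∀ᵐ x : ℝ, (𝓕 f : L2R) x = q x * (𝓕 φ : L2R) x) (ψ : L2R) :
    ∀ᵐ x : ℝ, ∑' n : ℤ, bracketTerm f ψ x n = q x * ∑' n : ℤ, bracketTerm φ ψ x n := by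
  filter_upwards [ae_forall_int_add h] with x hx
  rw [← tsum_mul_left]
  refine tsum_congr fun n => ?_
  rw [bracketTerm, bracketTerm, hx, periodic_add_int hq, mul_assoc]

theorem tsum_bracketTerm_of_fourier_eq_mul_right {ψ ψ' : L2R} {q : ℝ → ℂ}
    (hq : Function.Periodic q 1)
    (h : ∀ᵐ x : ℝ, (𝓕 ψ' : L2R) x = q x * (𝓕 ψ : L2R) x) (f : L2R) :
    ∀ᵐ x : ℝ, ∑' n : ℤ, bracketTerm f ψ' x n =
      starRingEnd ℂ (q x) * ∑' n : ℤ, bracketTerm f ψ x n := by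
  filter_upwards [ae_forall_int_add h] with x hx
  rw [← tsum_mul_left]
  refine tsum_congr fun n => ?_
  rw [bracketTerm, bracketTerm, hx, periodic_add_int hq, map_mul]
  ring

theorem periodic_fourier (k : ℤ) :
    Function.Periodic (fun x : ℝ => fourier k (x : UnitAddCircle)) 1 := fun x => by
  simp

theorem inner_shiftL2_eq_integral_bracket (k : ℤ) (ψ f : L2R) : inner ℂ (shiftL2 k ψ) f =
    ∫ x in Set.Ioc (0 : ℝ) 1, fourier k (x : UnitAddCircle) * ∑' n : ℤ, bracketTerm f ψ x n := by
  have hi : Integrable fun x : ℝ => fourier k (x : UnitAddCircle) *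
      ((𝓕 f : L2R) x * starRingEnd ℂ ((𝓕 ψ : L2R) x)) :=
    (integrable_fourier_mul_conj f ψ).bdd_mul (memLp_top_fourier k).1 (c := 1)
      (Filter.Eventually.of_forall fun x => by
        rw [fourier_apply]; exact (Circle.norm_coe _).le)
  rw [inner_shiftL2, hi.periodization.2.2]
  refine integral_congr_ae (Filter.Eventually.of_forall fun x => ?_)
  simp only [← tsum_mul_left]
  refine tsum_congr fun n => ?_
  rw [bracketTerm, periodic_add_int (periodic_fourier k)]

open Filter Topology in
/-- The mixed frame operator of two Bessel systems of translates acts on the Fourier side by the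
bracket product. -/
theorem fourier_tsum_inner_shiftL2 {φ ψ : L2R} (hφ : IsBesselSeq fun k : ℤ => shiftL2 k φ)
    (hψ : IsBesselSeq fun k : ℤ => shiftL2 k ψ) (f : L2R) :
    ∀ᵐ x : ℝ, (𝓕 (∑' k : ℤ, inner ℂ (shiftL2 k ψ) f • shiftL2 k φ) : L2R) x =
      (∑' n : ℤ, bracketTerm f ψ x n) * (𝓕 φ : L2R) x := by
  have : Fact ((0 : ℝ) < 1) := ⟨one_pos⟩
  set c : ℤ → ℂ := fun k => inner ℂ (shiftL2 k ψ) f with hc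
  obtain ⟨β, -, hB⟩ := hψ
  have hcs : Summable fun k => ‖c k‖ ^ 2 := (hB f).1
  have hmem : Memℓp (fun k => c (-k)) 2 := by
    refine memℓp_gen ?_
    simpa [Function.comp_def] using (Equiv.neg ℤ).summable_iff.2 hcs
  -- The index is negated because `T_k` becomes the character of frequency `-k`.
  set M : Lp ℂ 2 (AddCircle.haarAddCircle (T := 1)) :=
    fourierBasis.repr.symm ⟨fun k => c (-k), hmem⟩ with hM
  have hcoeff : ∀ k, fourierCoeff M k = c (-k) := fun k => by
    rw [← fourierBasis_repr, hM, LinearIsometryEquiv.apply_symm_apply]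
  have hvol : (volume : Measure UnitAddCircle) = AddCircle.haarAddCircle := by
    rw [AddCircle.volume_eq_smul_haarAddCircle]; simp
  have hae : ∀ {P : UnitAddCircle → Prop}, (∀ᵐ y ∂AddCircle.haarAddCircle, P y) →
      ∀ᵐ x : ℝ, P (x : UnitAddCircle) := fun h => by
    rw [← hvol] at h; exact ae_coe_unitAddCircle h
  -- The bracket is a priori only integrable; it equals the `L²` function `M` because their Fourier
  -- coefficients agree.
  have hMB : ∀ᵐ x : ℝ, M (x : UnitAddCircle) = ∑' n : ℤ, bracketTerm f ψ x n := by
    have hMi : IntegrableOn (fun x : ℝ => M (x : UnitAddCircle)) (Set.Ioc 0 1) := by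
      have h1 : Integrable M (volume : Measure UnitAddCircle) := by
        rw [hvol]; exact (Lp.memLp M).integrable (by norm_num)
      have h2 := (UnitAddCircle.measurePreserving_mk 0).integrable_comp_of_integrable h1
      simpa [IntegrableOn, Function.comp_def] using h2
    have hBi := (bracketTerm_summable_integrableOn f ψ).2
    have key : ∀ᵐ x : ℝ ∂(volume.restrict (Set.Ioc (0 : ℝ) 1)),
        M (x : UnitAddCircle) - ∑' n : ℤ, bracketTerm f ψ x n = 0 := by
      refine ae_eq_zero_of_integral_fourier_mul_eq_zero (hMi.sub hBi) fun k => ?_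
      have hb : ∀ᵐ x : ℝ ∂(volume.restrict (Set.Ioc (0 : ℝ) 1)),
          ‖fourier k (x : UnitAddCircle)‖ ≤ 1 := Eventually.of_forall fun x => by
        rw [fourier_apply]; exact (Circle.norm_coe _).le
      have hk := (memLp_top_fourier k).1.restrict (s := Set.Ioc (0 : ℝ) 1)
      simp only [mul_sub]
      rw [integral_sub (hMi.bdd_mul hk hb) (hBi.bdd_mul hk hb),
        ← inner_shiftL2_eq_integral_bracket, sub_eq_zero]
      have h1 := fourierCoeff_eq_intervalIntegral M (-k) 0
      rw [hcoeff, neg_neg] at h1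
      rw [show inner ℂ (shiftL2 k ψ) f = c k from rfl, h1,
        intervalIntegral.integral_of_le (by norm_num)]
      simp
    refine ae_of_ae_restrict_Ioc_of_periodic (fun n x hx => ?_) (key.mono fun x hx =>
      sub_eq_zero.1 hx)
    have h1 := periodic_add_int (periodic_tsum_bracketTerm f ψ) x n
    have h2 : ((x + n : ℝ) : UnitAddCircle) = x := by simp
    rwa [h2, h1] at hx
  have hsum := (hφ.summable_smul hcs).hasSum.comp Finset.tendsto_Icc_neg
  have hsum' := ((Lp.fourierTransformₗᵢ ℝ ℂ).continuous.tendsto _).comp hsum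
  obtain ⟨ns, hns, hlim⟩ := exists_subseq_tendsto_ae_of_tendsto_Lp hsum'
  have hMs := (Equiv.neg ℤ).hasSum_iff.2 (hasSum_fourier_series_L2 M)
  have hMs' := (hMs.comp Finset.tendsto_Icc_neg).comp hns
  -- This subsequence refines `ns`, so both series converge a.e. along the same symmetric partial
  -- sums.
  obtain ⟨ms, hms, hMlim⟩ := exists_subseq_tendsto_ae_of_tendsto_Lp hMs'
  have hcoe1 : ∀ᵐ x : ℝ, ∀ s : Finset ℤ,
      (Lp.fourierTransformₗᵢ ℝ ℂ (∑ k ∈ s, c k • shiftL2 k φ)) x =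
        (∑ k ∈ s, c k * fourier (-k) (x : UnitAddCircle)) * (𝓕 φ : L2R) x := by
    rw [ae_all_iff]
    intro s
    simp only [map_sum, map_smul]
    have h1 : ∀ᵐ x : ℝ, ∀ k : ℤ, (𝓕 (shiftL2 k φ) : L2R) x =
        fourier (-k) (x : UnitAddCircle) * (𝓕 φ : L2R) x :=
      ae_all_iff.2 fun k => fourier_shiftL2 k φ
    have h2 : ∀ᵐ x : ℝ, ∀ k : ℤ, (c k • (𝓕 (shiftL2 k φ) : L2R)) x =
        c k * (𝓕 (shiftL2 k φ) : L2R) x :=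
      ae_all_iff.2 fun k => Lp.coeFn_smul _ _
    filter_upwards [Lp.coeFn_finsetSum s fun k => c k • (𝓕 (shiftL2 k φ) : L2R), h1, h2]
      with x hx h1 h2
    refine hx.trans ?_
    rw [Finset.sum_apply, Finset.sum_mul]
    refine Finset.sum_congr rfl fun k _ => ?_
    rw [h2, h1, mul_assoc]
  have hcoe2 : ∀ᵐ y ∂(AddCircle.haarAddCircle (T := 1)), ∀ s : Finset ℤ,
      (∑ k ∈ s, fourierCoeff M (-k) • fourierLp (T := 1) 2 (-k)) y =
        ∑ k ∈ s, c k * fourier (-k) y := by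
    rw [ae_all_iff]
    intro s
    have h1 := ae_all_iff.2 fun k : ℤ => coeFn_fourierLp (T := 1) 2 (-k)
    have h2 := ae_all_iff.2 fun k : ℤ =>
      Lp.coeFn_smul (fourierCoeff M (-k)) (fourierLp (T := 1) 2 (-k))
    filter_upwards [Lp.coeFn_finsetSum s fun k => fourierCoeff M (-k) •
      fourierLp (T := 1) 2 (-k), h1, h2] with x hx h1 h2
    rw [hx, Finset.sum_apply]
    refine Finset.sum_congr rfl fun k _ => ?_
    rw [h2, Pi.smul_apply, h1, hcoeff, neg_neg, smul_eq_mul]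
  filter_upwards [hlim, hMB, hae hMlim, hcoe1, hae hcoe2]
    with x h1 h2 h3 h4 h5
  have h6 := h1.comp hms
  have h7 := h3.mul_const ((𝓕 φ : L2R) x)
  rw [h2] at h7
  refine tendsto_nhds_unique h6 (h7.congr fun i => ?_)
  simp only [Function.comp_apply, Equiv.neg_apply]
  rw [h4, h5]

/-! ### Periodic multipliers and principal shift-invariant spaces. -/

/-- A periodic function that is measurable up to null sets on a period agrees almost everywhere
with a measurable periodic function. -/
theorem exists_measurable_periodic_ae_eq {F : ℝ → ℂ} (hF : Function.Periodic F 1)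
    (hm : AEStronglyMeasurable F (volume.restrict (Set.Ioo (0 : ℝ) 1))) :
    ∃ G : ℝ → ℂ, Measurable G ∧ Function.Periodic G 1 ∧ ∀ᵐ x : ℝ, F x = G x := by
  refine ⟨fun x => hm.mk F (Int.fract x), hm.stronglyMeasurable_mk.measurable.comp measurable_fract,
    fun x => by simp, ae_of_ae_restrict_Ioc_of_periodic (fun n x hx => ?_) ?_⟩
  · simpa only [periodic_add_int hF, Int.fract_add_intCast] using hx
  · rw [← Measure.restrict_congr_set Ioo_ae_eq_Ioc]
    filter_upwards [hm.ae_eq_mk, ae_restrict_mem measurableSet_Ioo] with x hx hx'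
    rw [Int.fract_eq_self.2 ⟨hx'.1.le, hx'.2⟩, hx]

theorem memLp_top_of_periodic {F : ℝ → ℂ} (hF : Function.Periodic F 1)
    (hm : MemLp F ∞ (volume.restrict (Set.Ioo (0 : ℝ) 1))) : MemLp F ∞ volume := by
  obtain ⟨G, hG, -, hFG⟩ := exists_measurable_periodic_ae_eq hF hm.1
  refine memLp_top_of_bound (hG.aestronglyMeasurable.congr (hFG.mono fun x hx => hx.symm))
    (eLpNorm F ∞ (volume.restrict (Set.Ioo (0 : ℝ) 1))).toReal ?_
  refine ae_of_ae_restrict_Ioc_of_periodic (fun n x hx => ?_) ?_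
  · rwa [periodic_add_int hF] at hx
  · rw [← Measure.restrict_congr_set Ioo_ae_eq_Ioc]
    rw [eLpNorm_exponent_top]
    filter_upwards [enorm_ae_le_eLpNormEssSup F (volume.restrict (Set.Ioo (0 : ℝ) 1))] with x hx
    rw [← toReal_enorm]
    exact ENNReal.toReal_mono (by simpa using hm.2.ne) hx

/-- If `g` is orthogonal to all translates of `φ`, every Fourier coefficient of `[g, φ]` vanishes,
so `[g, f] = conj q · [g, φ] = 0` a.e. and `g ⟂ f`. The double orthogonal complement is the closed
span. No measurability or size condition on `q` enters. -/
theorem mem_shiftSpan_of_fourier_eq_mul {f φ : L2R} {q : ℝ → ℂ} (hq : Function.Periodic q 1)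
    (h : ∀ᵐ x : ℝ, (𝓕 f : L2R) x = q x * (𝓕 φ : L2R) x) : f ∈ shiftSpan φ := by
  rw [shiftSpan, ← Submodule.orthogonal_orthogonal_eq_closure, Submodule.mem_orthogonal]
  intro g hg
  have hg' : ∀ k : ℤ, inner ℂ (shiftL2 k φ) g = 0 := fun k =>
    (Submodule.mem_orthogonal _ _).1 hg _ (Submodule.subset_span ⟨k, rfl⟩)
  have h0 : ∀ᵐ x ∂(volume.restrict (Set.Ioc (0 : ℝ) 1)), ∑' n : ℤ, bracketTerm g φ x n = 0 :=
    ae_eq_zero_of_integral_fourier_mul_eq_zero (bracketTerm_summable_integrableOn g φ).2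
      fun k => by rw [← inner_shiftL2_eq_integral_bracket, hg']
  have h1 := inner_shiftL2_eq_integral_bracket 0 f g
  have h2 : shiftL2 0 f = f := by
    apply (Lp.fourierTransformₗᵢ ℝ ℂ).injective
    apply Lp.ext
    filter_upwards [fourier_shiftL2 0 f] with x hx
    refine hx.trans ?_
    simp
    rfl
  rw [h2] at h1
  rw [← inner_conj_symm, h1, integral_eq_zero_of_ae, map_zero]
  filter_upwards [h0, ae_restrict_of_ae (tsum_bracketTerm_of_fourier_eq_mul_right hq h g)]
    with x hx hx'
  rw [hx', hx]
  simp

open Filter Topology in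
/-- The principal shift-invariant space generated by `φ` consists of the functions whose Fourier
transform is a periodic multiple of that of `φ`. -/
theorem mem_shiftSpan_iff {f φ : L2R} : f ∈ shiftSpan φ ↔
    ∃ q : ℝ → ℂ, Function.Periodic q 1 ∧
      ∀ᵐ x : ℝ, (𝓕 f : L2R) x = q x * (𝓕 φ : L2R) x := by
  refine ⟨fun hf => ?_, fun ⟨q, hq, h⟩ => mem_shiftSpan_of_fourier_eq_mul hq h⟩
  have hspan : ∀ g ∈ Submodule.span ℂ (Set.range fun k : ℤ => shiftL2 k φ),
      ∃ q : ℝ → ℂ, Function.Periodic q 1 ∧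
        ∀ᵐ x : ℝ, (𝓕 g : L2R) x = q x * (𝓕 φ : L2R) x := by
    intro g hg
    induction hg using Submodule.span_induction with
    | mem g hg =>
      obtain ⟨k, rfl⟩ := hg
      exact ⟨_, periodic_fourier (-k), fourier_shiftL2 k φ⟩
    | zero =>
      refine ⟨0, fun x => rfl, ?_⟩
      rw [FourierTransform.fourier_zero]
      filter_upwards [Lp.coeFn_zero ℂ 2 (volume : Measure ℝ)] with x hx
      rw [hx]; simp
    | add g₁ g₂ _ _ h₁ h₂ =>
      obtain ⟨q₁, hq₁, h₁⟩ := h₁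
      obtain ⟨q₂, hq₂, h₂⟩ := h₂
      refine ⟨q₁ + q₂, hq₁.add hq₂, ?_⟩
      rw [FourierTransform.fourier_add]
      filter_upwards [Lp.coeFn_add (𝓕 g₁ : L2R) (𝓕 g₂ : L2R), h₁, h₂] with x hx h₁ h₂
      rw [hx, Pi.add_apply, h₁, h₂, Pi.add_apply, add_mul]
    | smul c g _ h =>
      obtain ⟨q, hq, h⟩ := h
      refine ⟨c • q, hq.smul c, ?_⟩
      rw [FourierTransform.fourier_smul]
      filter_upwards [Lp.coeFn_smul c (𝓕 g : L2R), h] with x hx h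
      rw [hx, Pi.smul_apply, h, Pi.smul_apply, smul_eq_mul, smul_eq_mul, mul_assoc]
  obtain ⟨g, hg, hlim⟩ := mem_closure_iff_seq_limit.1 hf
  choose p hp hpg using fun n => hspan (g n) (hg n)
  obtain ⟨ns, -, hns⟩ := exists_subseq_tendsto_ae_of_tendsto_Lp
    (((Lp.fourierTransformₗᵢ ℝ ℂ).continuous.tendsto f).comp hlim)
  -- The limit inherits exact periodicity from the `p n`. Where it may fail to exist, up to a null
  -- set, `φ̂ = 0` and its default value is harmless.
  refine ⟨fun x => limUnder atTop fun i => p (ns i) x, fun x => ?_, ?_⟩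
  · simp only [hp _ x]
  · filter_upwards [hns, ae_all_iff.2 hpg] with x h1 h2
    by_cases h0 : (𝓕 φ : L2R) x = 0
    · rw [h0, mul_zero]
      refine tendsto_nhds_unique h1 (tendsto_const_nhds.congr fun i => ?_)
      exact ((h2 (ns i)).trans (by rw [h0, mul_zero])).symm
    · have h3 : Tendsto (fun i => p (ns i) x) atTop (𝓝 ((𝓕 f : L2R) x / (𝓕 φ : L2R) x)) := by
        refine (h1.div_const ((𝓕 φ : L2R) x)).congr fun i => ?_
        rw [div_eq_iff h0]
        exact h2 (ns i)
      rw [h3.limUnder_eq, div_mul_cancel₀ _ h0]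

/-! ### Norm comparison and the equivalence. -/

/-- If `|g| ≥ ε |f|` almost everywhere and `‖g‖ ≤ ε ‖f‖`, then `|g| = ε |f|` almost everywhere. -/
theorem ae_eq_of_norm_le_of_ae_le {f g : L2R} {ε : ℝ} (hε : 0 ≤ ε) (h : ‖g‖ ≤ ε * ‖f‖)
    (hfg : ∀ᵐ x : ℝ, ε * ‖f x‖ ≤ ‖g x‖) : ∀ᵐ x : ℝ, ‖g x‖ = ε * ‖f x‖ := by
  have hn : ∀ u : L2R, Integrable (fun x => ‖u x‖ ^ 2) ∧ ‖u‖ ^ 2 = ∫ x, ‖u x‖ ^ 2 := fun u => by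
    have h1 := L2.integrable_inner (𝕜 := ℂ) u u
    have h2 : ∀ x, RCLike.re (inner ℂ (u x) (u x)) = ‖u x‖ ^ 2 := fun x =>
      inner_self_eq_norm_sq (u x)
    refine ⟨by simpa only [h2] using h1.re, ?_⟩
    rw [← inner_self_eq_norm_sq (𝕜 := ℂ) u, L2.inner_def, ← integral_re h1]
    simp only [h2]
  have hi : Integrable fun x => ‖g x‖ ^ 2 - ε ^ 2 * ‖f x‖ ^ 2 :=
    (hn g).1.sub ((hn f).1.const_mul _)
  have hpos : 0 ≤ᵐ[volume] fun x => ‖g x‖ ^ 2 - ε ^ 2 * ‖f x‖ ^ 2 := by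
    filter_upwards [hfg] with x hx
    have := pow_le_pow_left₀ (by positivity) hx 2
    rw [mul_pow] at this
    simpa using this
  have hle : ∫ x, (‖g x‖ ^ 2 - ε ^ 2 * ‖f x‖ ^ 2) ≤ 0 := by
    rw [integral_sub (hn g).1 ((hn f).1.const_mul _), integral_const_mul, ← (hn g).2, ← (hn f).2]
    have := pow_le_pow_left₀ (norm_nonneg _) h 2
    rw [mul_pow] at this
    linarith
  have := (integral_eq_zero_iff_of_nonneg_ae hpos hi).1 (hle.antisymm (integral_nonneg_of_ae hpos))
  filter_upwards [this] with x hx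
  rw [Pi.zero_apply, sub_eq_zero, ← mul_pow] at hx
  exact (pow_left_inj₀ (norm_nonneg _) (by positivity) two_ne_zero).1 hx

theorem mainTheorem5
    (φ φ₁ φt : L2R)
    (hφ : IsBesselSeq (fun k : ℤ => shiftL2 k φ))
    (hφ₁ : IsBesselSeq (fun k : ℤ => shiftL2 k φ₁))
    (hφt : φt ∈ shiftSpan φ₁)
    (H : ℝ → ℂ) (hHper : Function.Periodic H 1)
    (hH : MemLp H ∞ (volume.restrict (Set.Ioo (0 : ℝ) 1)))
    (hHφt : ∀ᵐ γ : ℝ, (𝓕 φt : L2R) γ = H γ * (𝓕 φ₁ : L2R) γ)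
    (ε : ℝ) (hε : 0 ≤ ε) :
    IsBesselSeq (fun k : ℤ => shiftL2 k φt) ∧
    (∀ f : L2R, Summable fun k : ℤ => inner ℂ (shiftL2 k φt) f • shiftL2 k φ) ∧
    (∀ᵐ γ ∂(volume.restrict (Set.Icc (0 : ℝ) 1)), Summable (bracketTerm φ φ₁ γ)) ∧
    ((∀ f ∈ shiftSpan φ,
        ‖f - ∑' k : ℤ, inner ℂ (shiftL2 k φt) f • shiftL2 k φ‖ ≤ ε * ‖f‖) ↔
      ∀ᵐ γ ∂(volume.restrict (Set.Icc (0 : ℝ) 1)), periodSq φ γ ≠ 0 →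
        ‖starRingEnd ℂ (H γ) * (∑' n : ℤ, bracketTerm φ φ₁ γ n) - 1‖ ≤ ε) := by
  have hB : IsBesselSeq (fun k : ℤ => shiftL2 k φt) :=
    hφ₁.of_fourier_eq_mul (memLp_top_of_periodic hHper hH) hHφt
  refine ⟨hB, fun f => ?_, ae_restrict_of_ae (bracketTerm_summable_integrableOn φ φ₁).1, ?_⟩
  · obtain ⟨β, -, h⟩ := hB
    exact hφ.summable_smul (h f).1
  set m : ℝ → ℂ := fun γ => starRingEnd ℂ (H γ) * ∑' n : ℤ, bracketTerm φ φ₁ γ n with hm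
  have hmper : Function.Periodic m 1 := fun x => by
    rw [hm]
    simp only [hHper x]
    exact congrArg _ (periodic_tsum_bracketTerm φ φ₁ x)
  have hmB : ∀ᵐ x : ℝ, ∑' n : ℤ, bracketTerm φ φt x n = m x :=
    tsum_bracketTerm_of_fourier_eq_mul_right hHper hHφt φ
  have herr : ∀ (f : L2R) (q : ℝ → ℂ), Function.Periodic q 1 →
      (∀ᵐ x : ℝ, (𝓕 f : L2R) x = q x * (𝓕 φ : L2R) x) → ∀ᵐ x : ℝ,
      (𝓕 (f - ∑' k : ℤ, inner ℂ (shiftL2 k φt) f • shiftL2 k φ) : L2R) x =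
        (1 - m x) * (𝓕 f : L2R) x := by
    intro f q hq hf
    rw [show (𝓕 (f - ∑' k : ℤ, inner ℂ (shiftL2 k φt) f • shiftL2 k φ) : L2R) = _ from
      map_sub (Lp.fourierTransformₗᵢ ℝ ℂ) _ _]
    filter_upwards [Lp.coeFn_sub (𝓕 f : L2R)
      (𝓕 (∑' k : ℤ, inner ℂ (shiftL2 k φt) f • shiftL2 k φ) : L2R), hf, hmB,
      fourier_tsum_inner_shiftL2 hφ hB f, tsum_bracketTerm_of_fourier_eq_mul hq hf φt]
      with x h1 h2 h3 h4 h5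
    refine h1.trans ?_
    rw [Pi.sub_apply, h4, h5, h3, h2]
    ring
  constructor
  · intro h
    -- `m` is only a.e. measurable; the representative `G` makes `S` both measurable and exactly
    -- periodic.
    obtain ⟨G, hG, hGper, hmG⟩ := exists_measurable_periodic_ae_eq hmper
      (((bracketTerm_summable_integrableOn φ φt).2.1.congr (ae_restrict_of_ae hmB)).mono_measure
        (Measure.restrict_mono_set _ Set.Ioo_subset_Ioc_self))
    let S : Set ℝ := {x | ε < ‖G x - 1‖}
    have hS : MeasurableSet S := measurableSet_lt measurable_const (hG.sub_const 1).norm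
    have hmem : MemLp (S.indicator (𝓕 φ : L2R)) 2 volume := (Lp.memLp (𝓕 φ : L2R)).indicator hS
    set f : L2R := 𝓕⁻ (hmem.toLp _) with hf
    have hff : (𝓕 f : L2R) = hmem.toLp _ := by
      rw [hf, FourierTransform.fourier_fourierInv_eq]
    have hfx : ∀ᵐ x : ℝ, (𝓕 f : L2R) x = S.indicator 1 x * (𝓕 φ : L2R) x := by
      rw [hff]
      filter_upwards [hmem.coeFn_toLp] with x hx
      rw [hx]
      by_cases hxS : x ∈ S <;> simp [hxS]
    have hSper : Function.Periodic (S.indicator (1 : ℝ → ℂ)) 1 := fun x => by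
      have : x + 1 ∈ S ↔ x ∈ S := by simp only [S, Set.mem_ofPred_eq, hGper x]
      by_cases hxS : x ∈ S
      · rw [Set.indicator_of_mem (this.2 hxS), Set.indicator_of_mem hxS]; rfl
      · rw [Set.indicator_of_notMem (mt this.1 hxS), Set.indicator_of_notMem hxS]
    have he := herr f _ hSper hfx
    have hnorm := h f (mem_shiftSpan_of_fourier_eq_mul hSper hfx)
    rw [← Lp.norm_fourier_eq, ← Lp.norm_fourier_eq f] at hnorm
    -- The error dominates `ε |f̂|` pointwise: strictly where `f̂ ≠ 0` on `S`, and trivially off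
    -- `S`, where `f̂ = 0`. The norm bound forces equality, so `φ̂` vanishes a.e. on `S`.
    have heq := ae_eq_of_norm_le_of_ae_le hε hnorm (by
      filter_upwards [he, hfx, hmG] with x h1 h2 h3
      rw [h1, norm_mul, h3, norm_sub_rev]
      by_cases hxS : x ∈ S
      · exact mul_le_mul_of_nonneg_right (le_of_lt hxS) (norm_nonneg _)
      · rw [h2]; simp [hxS])
    have hzero : ∀ᵐ x : ℝ, ε < ‖m x - 1‖ → (𝓕 φ : L2R) x = 0 := by
      filter_upwards [he, hfx, hmG, heq] with x h1 h2 h3 h4 hx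
      have hxS : x ∈ S := by rw [h3] at hx; exact hx
      rw [h1, norm_mul, norm_sub_rev] at h4
      rw [Set.indicator_of_mem hxS, Pi.one_apply, one_mul] at h2
      rw [h2] at h4
      by_contra h0
      exact hx.ne' (mul_right_cancel₀ (norm_ne_zero_iff.2 h0) h4)
    refine ae_restrict_of_ae ?_
    filter_upwards [ae_forall_int_add hzero] with x hx hΦ
    by_contra! hlt
    -- Since `m` is periodic, a bad `x` makes all `x + k` bad, so every term of `Φ(x)` vanishes.
    refine hΦ (ENNReal.tsum_eq_zero.2 fun k => ?_)
    rw [hx k (by rwa [periodic_add_int hmper])]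
    simp
  · intro h f hf
    obtain ⟨q, hq, hfq⟩ := mem_shiftSpan_iff.1 hf
    have hall : ∀ᵐ x : ℝ, periodSq φ x ≠ 0 → ‖m x - 1‖ ≤ ε := by
      refine ae_of_ae_restrict_Ioc_of_periodic (fun n x hx => ?_)
        (ae_restrict_of_ae_restrict_of_subset Set.Ioc_subset_Icc_self h)
      rwa [periodic_add_int hmper, periodic_add_int (periodic_periodSq φ)] at hx
    rw [← Lp.norm_fourier_eq, ← Lp.norm_fourier_eq f]
    refine Lp.norm_le_mul_norm_of_ae_le_mul ?_
    filter_upwards [hall, herr f q hq hfq, hfq] with x h1 h2 h3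
    rw [h2, norm_mul]
    by_cases h0 : (𝓕 φ : L2R) x = 0
    · rw [h3, h0]; simp
    · refine mul_le_mul_of_nonneg_right ?_ (norm_nonneg _)
      rw [norm_sub_rev]
      refine h1 fun hΦ => h0 ?_
      simpa using ENNReal.tsum_eq_zero.1 hΦ 0
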